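/- Let the abilities of $n$ contestants be i.i.d. with a bounded ability distribution $F$: for some $0\le a<b<\infty$, $F$ has a density $f$ that vanishes outside $[a,b]$ and is continuous and positive on $(a,b)$. In the contest with shortlist size $m$ ($2\le m\le n$), prizes $V_1\ge\dots\ge V_m\ge 0$ and cost $k e/x$ of effort $e$ at ability $x$ (with $k>0$), the $m$ most able contestants are admitted; an admitted contestant of ability $x$ exerts the (closed-form, symmetric equilibrium) effort $$b_{n,m,V}(x)=\frac1k\int_0^x\frac{\sum_{l=1}^{m-1}\binom{n-1}{l-1}(n-l)(V_l-V_{l+1})F(t)^{n-l-1}(1-F(t))^{l-1}f(t)}{\sum_{j=1}^{m}\binom{n-1}{j-1}F(t)^{n-j}(1-F(t))^{j-1}}\,t\,dt ,$$ and all other contestants exert effort $0$. Let $S(m,n,1)=\mathbb E\big[\sum_{i=1}^{m} b_{n,m,V}(X_{(i)})\big]$ denote the expected total effort for the winner-take-all prizes $V_1=B>0$, $V_2=\dots=V_m=0$, where $X_{(i)}$ is the $i$-th highest of the $n$ abilities. Then, for every such $F$ and all $B,k>0$, as $n\to\infty$, $$\frac{S(2,n,1)}{S(n,n,1)}=\Theta(\log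 n),$$ where the implied constants may depend on $F$. -/

import Mathlib

open MeasureTheory Set Filter Asymptotics

noncomputable section

/-- A bounded ability distribution: a probability density which vanishes outside `[lo, hi]`,
where `0 ≤ lo < hi < ∞`, and which is continuous and positive on `(lo, hi)`. -/
structure AbilityDistribution where
  lo : ℝ
  hi : ℝ
  pdf : ℝ → ℝ
  lo_nonneg : 0 ≤ lo
  lo_lt_hi : lo < hi
  pdf_nonneg : ∀ x, 0 ≤ pdf x
  pdf_pos : ∀ x ∈ Ioo lo hi, 0 < pdf x
  pdf_continuousOn : ContinuousOn pdf (Ioo lo hi)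
  pdf_eq_zero : ∀ x, x ∉ Icc lo hi → pdf x = 0
  integral_pdf : ∫ x, pdf x = 1

namespace AbilityDistribution

/-- The law of one contestant's ability. -/
def law (D : AbilityDistribution) : Measure ℝ :=
  volume.withDensity (fun x => ENNReal.ofReal (D.pdf x))

instance (D : AbilityDistribution) : IsProbabilityMeasure D.law := by
  have hint : Integrable D.pdf := by
    by_contra h
    have h1 := D.integral_pdf
    rw [integral_undef h] at h1
    exact zero_ne_one h1
  constructor
  rw [law, withDensity_apply _ MeasurableSet.univ, Measure.restrict_univ,
    ← ofReal_integral_eq_lintegral_ofReal hint (Eventually.of_forall D.pdf_nonneg),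
    D.integral_pdf, ENNReal.ofReal_one]

/-- The cumulative distribution function `F`. -/
def cdf (D : AbilityDistribution) (x : ℝ) : ℝ := D.law.real (Iic x)

/-- The law of the ability profile of `n` independent registered contestants. -/
def profileLaw (D : AbilityDistribution) (n : ℕ) : Measure (Fin n → ℝ) :=
  Measure.pi (fun _ => D.law)

/-- `J(F, n, m, t)`: the probability that a contestant of ability `t` is among the `m` most able
of `n` contestants. -/
def admissionProb (D : AbilityDistribution) (n m : ℕ) (t : ℝ) : ℝ :=
  ∑ j ∈ Finset.Icc 1 m,
    ((n - 1).choose (j - 1) : ℝ) * D.cdf t ^ (n - j) * (1 - D.cdf t) ^ (j - 1)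

/-- The closed-form equilibrium effort of an admitted contestant of ability `x`, when `m` of the `n` registered
contestants are admitted, the prizes are `V 1 ≥ V 2 ≥ ⋯ ≥ V m`, and an effort `e` costs
`k * e / x`. -/
def effort (D : AbilityDistribution) (k : ℝ) (n m : ℕ) (V : ℕ → ℝ) (x : ℝ) : ℝ :=
  (∫ t in (0 : ℝ)..x,
    (∑ l ∈ Finset.Icc 1 (m - 1),
      ((n - 1).choose (l - 1) : ℝ) * ((n - l : ℕ) : ℝ) * (V l - V (l + 1)) *
        D.cdf t ^ (n - l - 1) * (1 - D.cdf t) ^ (l - 1) * D.pdf t)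
      / D.admissionProb n m t * t) / k

end AbilityDistribution

/-- Contestant `i` is shortlisted if fewer than `m` contestants have a higher ability
(ties of abilities have probability zero). -/
def Shortlisted {n : ℕ} (m : ℕ) (X : Fin n → ℝ) (i : Fin n) : Prop :=
  {j : Fin n | X i < X j}.ncard < m

open Classical in
/-- Ex-ante expected total effort; eliminated contestants exert no effort. -/
def AbilityDistribution.totalEffort (D : AbilityDistribution) (k : ℝ) (n m : ℕ) (V : ℕ → ℝ) : ℝ :=
  ∫ X, ∑ i : Fin n, (if Shortlisted m X i then D.effort k n m V (X i) else 0) ∂D.profileLaw n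

/-- The winner-take-all prize structure: the first prize is the whole budget `B`. -/
def winnerTakeAll (B : ℝ) (l : ℕ) : ℝ := if l = 1 then B else 0

end

noncomputable section

namespace AbilityDistribution

variable (D : AbilityDistribution)

theorem integrable_pdf : Integrable D.pdf := by
  by_contra h
  have h1 := D.integral_pdf
  rw [integral_undef h] at h1
  exact zero_ne_one h1

theorem law_real (s : Set ℝ) (hs : MeasurableSet s) : D.law.real s = ∫ t in s, D.pdf t := by
  rw [measureReal_def, law, withDensity_apply _ hs,
    ← ofReal_integral_eq_lintegral_ofReal D.integrable_pdf.integrableOn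
      (Eventually.of_forall D.pdf_nonneg),
    ENNReal.toReal_ofReal (integral_nonneg D.pdf_nonneg)]

instance : NullSingletonClass D.law := by
  unfold law; infer_instance

theorem integral_law (g : ℝ → ℝ) : ∫ x, g x ∂D.law = ∫ x, D.pdf x * g x := by
  rw [law, integral_withDensity_eq_integral_toReal_smul₀
    D.integrable_pdf.aestronglyMeasurable.aemeasurable.ennreal_ofReal (by simp)]
  simp [ENNReal.toReal_ofReal, D.pdf_nonneg]

theorem pdf_of_lt {x : ℝ} (hx : x < D.lo) : D.pdf x = 0 :=
  D.pdf_eq_zero x fun h => absurd h.1 (not_le.2 hx)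

theorem pdf_of_gt {x : ℝ} (hx : D.hi < x) : D.pdf x = 0 :=
  D.pdf_eq_zero x fun h => absurd h.2 (not_le.2 hx)

theorem cdf_eq (x : ℝ) : D.cdf x = ∫ t in D.lo..x, D.pdf t := by
  rw [cdf, law_real _ _ measurableSet_Iic, ← intervalIntegral.integral_Iic_sub_Iic
    D.integrable_pdf.integrableOn D.integrable_pdf.integrableOn]
  rw [integral_Iic_eq_integral_Iio (x := D.lo),
    setIntegral_eq_zero_of_forall_eq_zero (t := Iio D.lo) fun t ht => D.pdf_of_lt ht, sub_zero]

theorem continuous_cdf : Continuous D.cdf := by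
  rw [show D.cdf = fun x => ∫ t in D.lo..x, D.pdf t from funext D.cdf_eq]
  exact intervalIntegral.continuous_primitive
    (fun _ _ => D.integrable_pdf.intervalIntegrable) _

theorem hasDerivAt_cdf {x : ℝ} (hx : x ∈ Ioo D.lo D.hi) : HasDerivAt D.cdf (D.pdf x) x := by
  rw [show D.cdf = fun x => ∫ t in D.lo..x, D.pdf t from funext D.cdf_eq]
  exact intervalIntegral.integral_hasDerivAt_right D.integrable_pdf.intervalIntegrable
    (D.pdf_continuousOn.stronglyMeasurableAtFilter isOpen_Ioo x hx)
    (D.pdf_continuousOn.continuousAt (isOpen_Ioo.mem_nhds hx))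

theorem cdf_mono : Monotone D.cdf := fun _ _ h =>
  measureReal_mono (Iic_subset_Iic.2 h)

theorem cdf_mem (x : ℝ) : D.cdf x ∈ Icc (0 : ℝ) 1 :=
  ⟨measureReal_nonneg, measureReal_le_one⟩

theorem cdf_lo : D.cdf D.lo = 0 := by
  rw [cdf_eq, intervalIntegral.integral_same]

theorem cdf_hi : D.cdf D.hi = 1 := by
  rw [cdf, law_real _ _ measurableSet_Iic, ← D.integral_pdf]
  exact setIntegral_eq_integral_of_forall_compl_eq_zero
    fun x hx => D.pdf_of_gt (not_le.1 hx)

theorem cdf_pos {x : ℝ} (hx : D.lo < x) : 0 < D.cdf x := by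
  have h : D.lo < min x D.hi := lt_min hx D.lo_lt_hi
  refine lt_of_lt_of_le ?_ (D.cdf_mono (min_le_left x D.hi))
  rw [cdf_eq]
  exact intervalIntegral.intervalIntegral_pos_of_pos_on D.integrable_pdf.intervalIntegrable
    (fun t ht => D.pdf_pos t ⟨ht.1, ht.2.trans_le (min_le_right _ _)⟩) h

theorem exists_cdf_eq {u : ℝ} (hu : u ∈ Icc (0 : ℝ) 1) :
    ∃ x ∈ Icc D.lo D.hi, D.cdf x = u := by
  have := intermediate_value_Icc D.lo_lt_hi.le D.continuous_cdf.continuousOn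
  rw [cdf_lo, cdf_hi] at this
  exact this hu

theorem law_real_Ici (x : ℝ) : D.law.real (Ici x) = 1 - D.cdf x := by
  rw [show Ici x = (Iio x)ᶜ by simp, measureReal_compl measurableSet_Iio, cdf,
    probReal_univ, measureReal_congr Iio_ae_eq_Iic]

theorem ae_law_mem : ∀ᵐ x ∂D.law, x ∈ Icc D.lo D.hi := by
  rw [ae_iff, ← measureReal_eq_zero_iff]
  change D.law.real (Icc D.lo D.hi)ᶜ = 0
  rw [law_real _ _ measurableSet_Icc.compl]
  exact setIntegral_eq_zero_of_forall_eq_zero fun x hx => D.pdf_eq_zero x hx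

theorem integrable_comp_cdf {φ : ℝ → ℝ} (hφ : ContinuousOn φ (Icc 0 1)) :
    Integrable fun t => φ (D.cdf t) * D.pdf t := by
  obtain ⟨C, hC⟩ := isCompact_Icc.exists_bound_of_continuousOn hφ
  refine D.integrable_pdf.bdd_mul (c := C) ?_ (Eventually.of_forall fun t => hC _ (D.cdf_mem t))
  exact (hφ.comp_continuous D.continuous_cdf D.cdf_mem).aestronglyMeasurable

theorem integral_comp_cdf {φ Φ : ℝ → ℝ} (hφ : ContinuousOn φ (Icc 0 1))
    (hΦ : ∀ u ∈ Icc (0 : ℝ) 1, HasDerivAt Φ (φ u) u) {x y : ℝ} (hx : D.lo ≤ x) (hxy : x ≤ y)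
    (hy : y ≤ D.hi) :
    ∫ t in x..y, φ (D.cdf t) * D.pdf t = Φ (D.cdf y) - Φ (D.cdf x) := by
  refine intervalIntegral.integral_eq_sub_of_hasDerivAt_of_le (f := fun t => Φ (D.cdf t)) hxy ?_ ?_
    (D.integrable_comp_cdf hφ).intervalIntegrable
  · intro t _
    exact ((hΦ _ (D.cdf_mem t)).continuousAt.comp D.continuous_cdf.continuousAt).continuousWithinAt
  · intro t ht
    exact (hΦ _ (D.cdf_mem t)).comp t
      (D.hasDerivAt_cdf ⟨hx.trans_lt ht.1, ht.2.trans_le hy⟩)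

/-- The effort at cost `e / x` whose marginal value of rank `u` is `φ u`. -/
def rankEffort (φ : ℝ → ℝ) (x : ℝ) : ℝ := ∫ t in (0 : ℝ)..x, φ (D.cdf t) * D.pdf t * t

variable {φ Φ : ℝ → ℝ}

theorem integrable_rankEffort (hφ : ContinuousOn φ (Icc 0 1)) :
    Integrable fun t => φ (D.cdf t) * D.pdf t * t := by
  have h := (D.integrable_comp_cdf hφ).norm.const_mul D.hi
  refine h.mono' ((D.integrable_comp_cdf hφ).aestronglyMeasurable.mul
    continuous_id.aestronglyMeasurable) (Eventually.of_forall fun t => ?_)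
  by_cases ht : t ∈ Icc D.lo D.hi
  · rw [norm_mul, mul_comm, Real.norm_of_nonneg (D.lo_nonneg.trans ht.1)]
    exact mul_le_mul_of_nonneg_right ht.2 (norm_nonneg _)
  · simp [D.pdf_eq_zero t ht]

theorem rankEffort_sub (hφ : ContinuousOn φ (Icc 0 1)) (x y : ℝ) :
    D.rankEffort φ y - D.rankEffort φ x = ∫ t in x..y, φ (D.cdf t) * D.pdf t * t :=
  intervalIntegral.integral_interval_sub_left (D.integrable_rankEffort hφ).intervalIntegrable
    (D.integrable_rankEffort hφ).intervalIntegrable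

theorem rankEffort_integrand_nonneg (h0 : ∀ u ∈ Icc (0 : ℝ) 1, 0 ≤ φ u) (t : ℝ) :
    0 ≤ φ (D.cdf t) * D.pdf t * t := by
  by_cases ht : t < D.lo
  · simp [D.pdf_of_lt ht]
  · exact mul_nonneg (mul_nonneg (h0 _ (D.cdf_mem t)) (D.pdf_nonneg t))
      (D.lo_nonneg.trans (not_lt.1 ht))

theorem rankEffort_mono (hφ : ContinuousOn φ (Icc 0 1)) (h0 : ∀ u ∈ Icc (0 : ℝ) 1, 0 ≤ φ u) :
    Monotone (D.rankEffort φ) := fun x y h => by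
  rw [← sub_nonneg, rankEffort_sub _ hφ]
  exact intervalIntegral.integral_nonneg h fun t _ => D.rankEffort_integrand_nonneg h0 t

theorem rankEffort_lo (φ : ℝ → ℝ) : D.rankEffort φ D.lo = 0 := by
  rw [rankEffort, intervalIntegral.integral_of_le D.lo_nonneg, integral_Ioc_eq_integral_Ioo]
  exact setIntegral_eq_zero_of_forall_eq_zero fun t ht => by simp [D.pdf_of_lt ht.2]

theorem rankEffort_nonneg (hφ : ContinuousOn φ (Icc 0 1)) (h0 : ∀ u ∈ Icc (0 : ℝ) 1, 0 ≤ φ u)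
    (x : ℝ) : 0 ≤ D.rankEffort φ x := by
  rcases le_total D.lo x with h | h
  · exact (D.rankEffort_lo φ).ge.trans (D.rankEffort_mono hφ h0 h)
  · have := D.rankEffort_sub hφ x D.lo
    rw [D.rankEffort_lo φ, intervalIntegral.integral_of_le h, integral_Ioc_eq_integral_Ioo,
      setIntegral_eq_zero_of_forall_eq_zero fun t ht => by simp [D.pdf_of_lt ht.2]] at this
    linarith

theorem rankEffort_le (hφ : ContinuousOn φ (Icc 0 1)) (h0 : ∀ u ∈ Icc (0 : ℝ) 1, 0 ≤ φ u)
    (hΦ : ∀ u ∈ Icc (0 : ℝ) 1, HasDerivAt Φ (φ u) u) {x : ℝ} (hx : x ∈ Icc D.lo D.hi) :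
    D.rankEffort φ x ≤ D.hi * (Φ (D.cdf x) - Φ 0) := by
  have h := D.rankEffort_sub hφ D.lo x
  rw [D.rankEffort_lo φ, sub_zero] at h
  rw [h, ← D.cdf_lo, ← D.integral_comp_cdf hφ hΦ le_rfl hx.1 hx.2,
    ← intervalIntegral.integral_const_mul]
  refine intervalIntegral.integral_mono_on hx.1 (D.integrable_rankEffort hφ).intervalIntegrable
    ((D.integrable_comp_cdf hφ).const_mul _).intervalIntegrable fun t ht => ?_
  rw [mul_comm]
  exact mul_le_mul_of_nonneg_right (ht.2.trans hx.2)
    (mul_nonneg (h0 _ (D.cdf_mem t)) (D.pdf_nonneg t))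

theorem le_rankEffort (hφ : ContinuousOn φ (Icc 0 1)) (h0 : ∀ u ∈ Icc (0 : ℝ) 1, 0 ≤ φ u)
    (hΦ : ∀ u ∈ Icc (0 : ℝ) 1, HasDerivAt Φ (φ u) u) {x y : ℝ} (hx : D.lo ≤ x) (hxy : x ≤ y)
    (hy : y ≤ D.hi) :
    x * (Φ (D.cdf y) - Φ (D.cdf x)) ≤ D.rankEffort φ y := by
  have h := D.rankEffort_sub hφ x y
  have h2 := D.rankEffort_nonneg hφ h0 x
  refine le_trans ?_ (h.symm.le.trans (sub_le_self _ h2))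
  rw [← D.integral_comp_cdf hφ hΦ hx hxy hy, ← intervalIntegral.integral_const_mul]
  refine intervalIntegral.integral_mono_on hxy
    ((D.integrable_comp_cdf hφ).const_mul _).intervalIntegrable
    (D.integrable_rankEffort hφ).intervalIntegrable fun t ht => ?_
  rw [mul_comm _ t]
  exact mul_le_mul_of_nonneg_right ht.1
    (mul_nonneg (h0 _ (D.cdf_mem t)) (D.pdf_nonneg t))

theorem rankEffort_le_hi (hφ : ContinuousOn φ (Icc 0 1)) (x : ℝ)
    (h0 : ∀ u ∈ Icc (0 : ℝ) 1, 0 ≤ φ u) : D.rankEffort φ x ≤ D.rankEffort φ D.hi := by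
  rcases le_total x D.hi with h | h
  · exact D.rankEffort_mono hφ h0 h
  · have := D.rankEffort_sub hφ D.hi x
    rw [intervalIntegral.integral_of_le h,
      setIntegral_eq_zero_of_forall_eq_zero fun t ht => by simp [D.pdf_of_gt ht.1]] at this
    linarith

theorem effort_winnerTakeAll (B k : ℝ) {n m : ℕ} (hm : 2 ≤ m) (x : ℝ) :
    D.effort k n m (winnerTakeAll B) x = (∫ t in (0 : ℝ)..x,
      (((n - 1 : ℕ) : ℝ) * B * D.cdf t ^ (n - 2) * D.pdf t) / D.admissionProb n m t * t) / k := by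
  unfold effort
  congr 2
  funext t
  rw [Finset.sum_eq_single_of_mem 1 (by simp; omega)]
  · simp [winnerTakeAll, Nat.sub_sub]
  · intro l hl hl1
    have := (Finset.mem_Icc.1 hl).1
    simp [winnerTakeAll, hl1]
    omega

theorem admissionProb_self {n : ℕ} (hn : 1 ≤ n) (t : ℝ) : D.admissionProb n n t = 1 := by
  obtain ⟨N, rfl⟩ : ∃ N, n = N + 1 := ⟨n - 1, by omega⟩
  have h := add_pow (1 - D.cdf t) (D.cdf t) N
  rw [sub_add_cancel, one_pow] at h
  rw [h, admissionProb, ← Finset.Ico_succ_right_eq_Icc, Finset.sum_Ico_eq_sum_range]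
  refine Finset.sum_congr (by simp) fun j _ => ?_
  rw [show N + 1 - (1 + j) = N - j by omega, show 1 + j - 1 = j by omega]
  simp
  ring

theorem admissionProb_two {n : ℕ} (hn : 2 ≤ n) (t : ℝ) :
    D.admissionProb n 2 t = D.cdf t ^ (n - 2) * ((n - 1) - (n - 2) * D.cdf t) := by
  obtain ⟨N, rfl⟩ : ∃ N, n = N + 2 := ⟨n - 2, by omega⟩
  simp [admissionProb, Finset.sum_Icc_succ_top]
  ring

/-- The marginal value of rank when everybody is admitted. -/
def openWeight (n : ℕ) (u : ℝ) : ℝ := ((n - 1 : ℕ) : ℝ) * u ^ (n - 2)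

/-- The marginal value of rank when two contestants are admitted. -/
def pairWeight (n : ℕ) (u : ℝ) : ℝ := ((n : ℝ) - 1) / ((n - 1) - (n - 2) * u)

theorem effort_open (B k : ℝ) {n : ℕ} (hn : 2 ≤ n) (x : ℝ) :
    D.effort k n n (winnerTakeAll B) x = B / k * D.rankEffort (openWeight n) x := by
  rw [effort_winnerTakeAll _ _ _ hn, rankEffort, div_mul_eq_mul_div,
    ← intervalIntegral.integral_const_mul]
  congr 2
  funext t
  rw [admissionProb_self _ (by omega), openWeight]
  ring

theorem effort_pair (B k : ℝ) {n : ℕ} (hn : 2 ≤ n) (x : ℝ) :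
    D.effort k n 2 (winnerTakeAll B) x = B / k * D.rankEffort (pairWeight n) x := by
  rw [effort_winnerTakeAll _ _ _ le_rfl, rankEffort, div_mul_eq_mul_div,
    ← intervalIntegral.integral_const_mul]
  congr 1
  refine intervalIntegral.integral_congr_ae ?_
  filter_upwards [compl_mem_ae_iff.2 (measure_singleton D.lo)] with t ht _
  rcases lt_or_gt_of_ne ht with h | h
  · simp [D.pdf_of_lt h]
  · have hF := (D.cdf_pos h).ne'
    rw [admissionProb_two _ hn, pairWeight, mul_assoc, mul_div_assoc,
      Nat.cast_sub (by omega : 1 ≤ n)]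
    field_simp
    simp only [Nat.cast_one]
    ring

end AbilityDistribution

section Shortlist

variable {n : ℕ}

theorem shortlisted_of_le {X : Fin n → ℝ} (i : Fin n) : Shortlisted n X i := by
  have h : ({j : Fin n | X i < X j} : Set (Fin n)) ⊂ univ :=
    (ssubset_univ_iff).2 fun h => lt_irrefl (X i) (h.symm ▸ mem_univ i : i ∈ {j | X i < X j})
  have := ncard_lt_ncard h
  rwa [ncard_univ, Nat.card_eq_fintype_card, Fintype.card_fin] at this

theorem shortlisted_of_isMax {m : ℕ} (hm : 0 < m) {X : Fin n → ℝ} {i : Fin n}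
    (h : ∀ j, X j ≤ X i) : Shortlisted m X i := by
  have : {j : Fin n | X i < X j} = ∅ := eq_empty_of_forall_notMem fun j hj => (h j).not_gt hj
  rw [Shortlisted, this, ncard_empty]
  exact hm

open Classical in
theorem card_shortlisted_le {m : ℕ} {X : Fin n → ℝ} (hX : Function.Injective X) :
    (Finset.univ.filter fun i => Shortlisted m X i).card ≤ m := by
  set T := Finset.univ.filter fun i => Shortlisted m X i with hT
  rcases T.eq_empty_or_nonempty with h | h
  · simp [h]
  obtain ⟨i, hi, hmin⟩ := T.exists_min_image X h
  have hsub : (↑(T.erase i) : Set (Fin n)) ⊆ {j | X i < X j} := fun j hj => by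
    have hj' := Finset.mem_erase.1 (Finset.mem_coe.1 hj)
    exact lt_of_le_of_ne (hmin j hj'.2) fun h => hj'.1 (hX h).symm
  have h1 := ncard_le_ncard hsub
  rw [ncard_coe_finset, Finset.card_erase_of_mem hi] at h1
  have h2 : Shortlisted m X i := (Finset.mem_filter.1 hi).2
  unfold Shortlisted at h2
  omega

theorem measurableSet_shortlisted (m : ℕ) (i : Fin n) :
    MeasurableSet {X : Fin n → ℝ | Shortlisted m X i} := by
  classical
  have h : ∀ X : Fin n → ℝ, {j : Fin n | X i < X j}.ncard = ∑ j, if X i < X j then 1 else 0 :=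
    fun X => by
      rw [← Finset.card_filter, ← ncard_coe_finset]
      simp
  simp only [Shortlisted, h]
  refine measurableSet_lt (Finset.measurable_sum _ fun j _ => ?_) measurable_const
  exact Measurable.ite (measurableSet_lt (measurable_pi_apply i) (measurable_pi_apply j))
    measurable_const measurable_const

end Shortlist

namespace AbilityDistribution

variable (D : AbilityDistribution) {n : ℕ}

instance : IsProbabilityMeasure (D.profileLaw n) := by
  unfold profileLaw; infer_instance

theorem measurePreserving_eval_profileLaw (i : Fin n) :
    MeasurePreserving (Function.eval i) (D.profileLaw n) D.law :=
  measurePreserving_eval (fun _ => D.law) i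

theorem ae_profileLaw_ne {i j : Fin n} (h : i ≠ j) : ∀ᵐ X ∂D.profileLaw n, X i ≠ X j := by
  have hind : ProbabilityTheory.iIndepFun (fun (i : Fin n) (X : Fin n → ℝ) => X i)
      (D.profileLaw n) :=
    ProbabilityTheory.iIndepFun_pi (X := fun _ => id) fun _ => aemeasurable_id
  have hp := (ProbabilityTheory.indepFun_iff_map_prod_eq_prod_map_map
    (measurable_pi_apply i).aemeasurable (measurable_pi_apply j).aemeasurable).1
    (hind.indepFun h)
  rw [(D.measurePreserving_eval_profileLaw i).map_eq,
    (D.measurePreserving_eval_profileLaw j).map_eq] at hp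
  have hd : ∀ᵐ p ∂(D.law.prod D.law), p.1 ≠ p.2 := by
    have hms : MeasurableSet {p : ℝ × ℝ | p.1 ≠ p.2} :=
      (measurableSet_eq_fun measurable_fst measurable_snd).compl
    rw [Measure.ae_prod_iff_ae_ae hms]
    refine Eventually.of_forall fun x => ?_
    filter_upwards [compl_mem_ae_iff.2 (measure_singleton (μ := D.law) x)] with y hy hxy
    exact hy hxy.symm
  rw [← hp] at hd
  exact ae_of_ae_map ((measurable_pi_apply i).prodMk (measurable_pi_apply j)).aemeasurable hd

theorem ae_profileLaw_injective : ∀ᵐ X ∂D.profileLaw n, Function.Injective X := by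
  have : ∀ i j : Fin n, ∀ᵐ X ∂D.profileLaw n, i ≠ j → X i ≠ X j := fun i j => by
    by_cases h : i = j
    · exact Eventually.of_forall fun _ h' => absurd h h'
    · filter_upwards [D.ae_profileLaw_ne h] with X hX _ using hX
  filter_upwards [ae_all_iff.2 fun i => ae_all_iff.2 (this i)] with X hX i j hij
  by_contra h
  exact hX i j h hij

theorem profileLaw_exists_ge (x : ℝ) :
    (D.profileLaw n).real {X | ∃ i, x ≤ X i} = 1 - D.cdf x ^ n := by
  have h : {X : Fin n → ℝ | ∃ i, x ≤ X i} = (univ.pi fun _ => Iio x)ᶜ := by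
    ext X; simp
  have hI : D.law (Iio x) = D.law (Iic x) := measure_congr Iio_ae_eq_Iic
  rw [h, measureReal_compl (MeasurableSet.univ_pi fun _ => measurableSet_Iio), probReal_univ,
    measureReal_def, profileLaw, Measure.pi_pi]
  simp [hI, cdf, measureReal_def]

open Classical in
theorem integrable_shortlist_sum {m : ℕ} {b : ℝ → ℝ} (hb : Measurable b) {C : ℝ}
    (hC : ∀ x, |b x| ≤ C) :
    Integrable (fun X : Fin n → ℝ => ∑ i, if Shortlisted m X i then b (X i) else 0)
      (D.profileLaw n) := by
  refine integrable_finsetSum _ fun i _ => ?_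
  refine Integrable.of_bound (C := C) (Measurable.ite (measurableSet_shortlisted m i)
    (hb.comp (measurable_pi_apply i)) measurable_const).aestronglyMeasurable
    (Eventually.of_forall fun X => ?_)
  split_ifs
  · exact hC _
  · simpa using (abs_nonneg _).trans (hC 0)

open Classical in
theorem integral_shortlist_sum_le {m : ℕ} {b : ℝ → ℝ} (hb : Measurable b) {C : ℝ}
    (h0 : ∀ x, 0 ≤ b x) (hC : ∀ x, b x ≤ C) :
    ∫ X : Fin n → ℝ, ∑ i, (if Shortlisted m X i then b (X i) else 0) ∂D.profileLaw n ≤ m * C := by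
  have hi := D.integrable_shortlist_sum (n := n) (m := m) hb fun x =>
    (abs_of_nonneg (h0 x)).le.trans (hC x)
  refine (integral_mono_ae hi (integrable_const ((m : ℝ) * C)) ?_).trans (by simp)
  filter_upwards [D.ae_profileLaw_injective] with X hX
  rw [← Finset.sum_filter]
  refine (Finset.sum_le_card_nsmul _ _ C fun i _ => hC _).trans ?_
  rw [nsmul_eq_mul]
  exact mul_le_mul_of_nonneg_right (by exact_mod_cast card_shortlisted_le hX)
    ((h0 0).trans (hC 0))

open Classical in
theorem le_integral_shortlist_sum {m : ℕ} (hm : 0 < m) {b : ℝ → ℝ} (hb : Monotone b) {C : ℝ}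
    (h0 : ∀ x, 0 ≤ b x) (hC : ∀ x, b x ≤ C) (x : ℝ) :
    b x * (1 - D.cdf x ^ n) ≤
      ∫ X : Fin n → ℝ, ∑ i, (if Shortlisted m X i then b (X i) else 0) ∂D.profileLaw n := by
  have hi := D.integrable_shortlist_sum (n := n) (m := m) hb.measurable fun x =>
    (abs_of_nonneg (h0 x)).le.trans (hC x)
  have hms : MeasurableSet {X : Fin n → ℝ | ∃ i, x ≤ X i} := by
    rw [ofPred_exists]
    exact MeasurableSet.iUnion fun i => measurableSet_le measurable_const (measurable_pi_apply i)
  rw [← profileLaw_exists_ge, mul_comm, ← smul_eq_mul, ← integral_indicator_const _ hms]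
  refine integral_mono ((integrable_const _).indicator hms) hi fun X => ?_
  have hnn : ∀ (X : Fin n → ℝ) i, 0 ≤ (if Shortlisted m X i then b (X i) else 0) := fun X i => by
    split_ifs
    exacts [h0 _, le_rfl]
  refine indicator_le' (fun X hX => ?_) (fun X _ => Finset.sum_nonneg fun i _ => hnn X i) X
  obtain ⟨i, hxi⟩ := hX
  obtain ⟨j, -, hj⟩ := Finset.exists_max_image Finset.univ X ⟨i, Finset.mem_univ i⟩
  refine le_trans ?_ (Finset.single_le_sum (fun i _ => hnn X i) (Finset.mem_univ j))
  rw [if_pos (shortlisted_of_isMax hm fun l => hj l (Finset.mem_univ l))]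
  exact hb (hxi.trans (hj i (Finset.mem_univ i)))

open Classical in
theorem integral_sum_all {b : ℝ → ℝ} (hb : Measurable b) {C : ℝ} (hC : ∀ x, |b x| ≤ C) :
    ∫ X : Fin n → ℝ, ∑ i, (if Shortlisted n X i then b (X i) else 0) ∂D.profileLaw n =
      n * ∫ x, b x ∂D.law := by
  simp only [shortlisted_of_le, if_true]
  have hint : Integrable b D.law :=
    Integrable.of_bound hb.aestronglyMeasurable C (Eventually.of_forall hC)
  have hi : ∀ i : Fin n, Integrable (fun X : Fin n → ℝ => b (X i)) (D.profileLaw n) := fun i =>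
    (D.measurePreserving_eval_profileLaw i).integrable_comp_of_integrable hint
  rw [integral_finsetSum _ fun i _ => hi i]
  have : ∀ i : Fin n, ∫ X : Fin n → ℝ, b (X i) ∂D.profileLaw n = ∫ x, b x ∂D.law := fun i => by
    rw [← (D.measurePreserving_eval_profileLaw i).map_eq,
      integral_map (measurable_pi_apply i).aemeasurable hb.aestronglyMeasurable]
  simp [this]

theorem continuousOn_openWeight (n : ℕ) : ContinuousOn (openWeight n) (Icc 0 1) := by
  unfold openWeight; fun_prop

theorem openWeight_nonneg (n : ℕ) : ∀ u ∈ Icc (0 : ℝ) 1, 0 ≤ openWeight n u := fun u hu => by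
  have := hu.1
  unfold openWeight; positivity

theorem hasDerivAt_openWeight (n : ℕ) (u : ℝ) :
    HasDerivAt (fun u : ℝ => u ^ (n - 1)) (openWeight n u) u := by
  simpa [openWeight, Nat.sub_sub] using hasDerivAt_pow (n - 1) u

theorem pairWeight_den_pos (hn : 2 ≤ n) {u : ℝ} (hu : u ∈ Icc (0 : ℝ) 1) :
    0 < (n : ℝ) - 1 - (n - 2) * u := by
  have h : (2 : ℝ) ≤ n := by exact_mod_cast hn
  nlinarith [hu.2, hu.1]

theorem continuousOn_pairWeight (hn : 2 ≤ n) : ContinuousOn (pairWeight n) (Icc 0 1) := by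
  unfold pairWeight
  exact ContinuousOn.div (by fun_prop) (by fun_prop) fun u hu => (pairWeight_den_pos hn hu).ne'

theorem pairWeight_nonneg (hn : 2 ≤ n) : ∀ u ∈ Icc (0 : ℝ) 1, 0 ≤ pairWeight n u := fun u hu => by
  have h : (2 : ℝ) ≤ n := by exact_mod_cast hn
  exact div_nonneg (by linarith) (pairWeight_den_pos hn hu).le

theorem hasDerivAt_pairWeight (hn : 3 ≤ n) : ∀ u ∈ Icc (0 : ℝ) 1,
    HasDerivAt (fun u : ℝ => -((n - 1) / (n - 2) * Real.log ((n : ℝ) - 1 - (n - 2) * u)))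
      (pairWeight n u) u := fun u hu => by
  have h : (3 : ℝ) ≤ n := by exact_mod_cast hn
  have hd := (pairWeight_den_pos (by omega : 2 ≤ n) hu).ne'
  have h2 : (n : ℝ) - 2 ≠ 0 := by linarith
  have := ((((hasDerivAt_id u).const_mul ((n : ℝ) - 2)).const_sub ((n : ℝ) - 1)).log
    hd).const_mul (((n : ℝ) - 1) / (n - 2))
  refine this.neg.congr_deriv ?_
  rw [pairWeight]
  simp only [id]
  field_simp

theorem exists_median : ∃ x ∈ Icc D.lo D.hi, 0 < x ∧ D.cdf x = 1 / 2 := by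
  obtain ⟨x, hx, h⟩ := D.exists_cdf_eq (u := 1 / 2) (by norm_num)
  refine ⟨x, hx, D.lo_nonneg.trans_lt (lt_of_le_of_ne hx.1 fun h' => ?_), h⟩
  rw [← h', cdf_lo] at h
  norm_num at h

theorem exists_top_quantile (hn : 1 ≤ n) : ∃ x ∈ Icc D.lo D.hi, D.cdf x = 1 - 1 / n := by
  have h : (1 : ℝ) ≤ n := by exact_mod_cast hn
  refine D.exists_cdf_eq ⟨?_, ?_⟩
  · rw [sub_nonneg]; exact (div_le_one (by linarith)).2 h
  · have : (0 : ℝ) ≤ 1 / n := by positivity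
    linarith

theorem le_of_cdf_lt {x y : ℝ} (h : D.cdf x < D.cdf y) : x ≤ y :=
  (D.cdf_mono.reflect_lt h).le

section totals

variable {B k : ℝ}

theorem totalEffort_open_eq (hn : 2 ≤ n) :
    D.totalEffort k n n (winnerTakeAll B) =
      B / k * (n * ∫ x, D.rankEffort (openWeight n) x ∂D.law) := by
  have h0 := openWeight_nonneg n
  have hc := continuousOn_openWeight n
  rw [← D.integral_sum_all (D.rankEffort_mono hc h0).measurable fun x =>
    (abs_of_nonneg (D.rankEffort_nonneg hc h0 x)).le.trans (D.rankEffort_le_hi hc x h0),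
    ← integral_const_mul, totalEffort]
  simp only [Finset.mul_sum, mul_ite, mul_zero, D.effort_open B k hn]

open Classical in
theorem totalEffort_pair_eq (hn : 2 ≤ n) :
    D.totalEffort k n 2 (winnerTakeAll B) =
      B / k * ∫ X : Fin n → ℝ, ∑ i, (if Shortlisted 2 X i then
        D.rankEffort (pairWeight n) (X i) else 0) ∂D.profileLaw n := by
  rw [← integral_const_mul, totalEffort]
  simp only [Finset.mul_sum, mul_ite, mul_zero, D.effort_pair B k hn]

theorem totalEffort_open_le (hBk : 0 ≤ B / k) (hn : 2 ≤ n) :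
    D.totalEffort k n n (winnerTakeAll B) ≤ B / k * D.hi := by
  rw [totalEffort_open_eq _ hn]
  refine mul_le_mul_of_nonneg_left ?_ hBk
  have h0 := openWeight_nonneg n
  have hc := continuousOn_openWeight n
  have hcp : ContinuousOn (fun u : ℝ => n * u ^ (n - 1)) (Icc 0 1) := by fun_prop
  have hn0 : n - 1 ≠ 0 := by omega
  have hint : Integrable (fun x => D.hi * D.cdf x ^ (n - 1)) D.law := by
    refine Integrable.of_bound
      ((D.continuous_cdf.pow _).const_mul _ |>.aestronglyMeasurable) D.hi
      (Eventually.of_forall fun x => ?_)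
    have := D.cdf_mem x
    have hhi := D.lo_nonneg.trans D.lo_lt_hi.le
    rw [Real.norm_of_nonneg (mul_nonneg hhi (pow_nonneg this.1 _))]
    exact mul_le_of_le_one_right hhi (pow_le_one₀ this.1 this.2)
  have h1 : ∫ x, D.rankEffort (openWeight n) x ∂D.law ≤
      ∫ x, D.hi * D.cdf x ^ (n - 1) ∂D.law := by
    refine integral_mono_of_nonneg (Eventually.of_forall fun x => D.rankEffort_nonneg hc h0 x)
      hint ?_
    filter_upwards [D.ae_law_mem] with x hx
    simpa [hn0] using D.rankEffort_le hc h0 (fun u _ => hasDerivAt_openWeight n u) hx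
  have h2 : (n : ℝ) * ∫ x, D.cdf x ^ (n - 1) ∂D.law = 1 := by
    rw [integral_law, ← integral_const_mul]
    have := D.integral_comp_cdf hcp (Φ := fun u => u ^ n) (fun u _ => hasDerivAt_pow n u) le_rfl
      D.lo_lt_hi.le le_rfl
    rw [cdf_hi, cdf_lo, one_pow, zero_pow (by omega), sub_zero,
      intervalIntegral.integral_of_le D.lo_lt_hi.le, ← integral_Icc_eq_integral_Ioc,
      setIntegral_eq_integral_of_forall_compl_eq_zero
        fun x hx => by rw [D.pdf_eq_zero x hx, mul_zero]] at this
    rw [← this]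
    congr 1
    funext x
    ring
  calc (n : ℝ) * ∫ x, D.rankEffort (openWeight n) x ∂D.law
      ≤ n * ∫ x, D.hi * D.cdf x ^ (n - 1) ∂D.law := by gcongr
    _ = D.hi * (n * ∫ x, D.cdf x ^ (n - 1) ∂D.law) := by rw [integral_const_mul]; ring
    _ = D.hi := by rw [h2, mul_one]

theorem one_third_le_pow (hn : 2 ≤ n) : (1 : ℝ) / 3 ≤ (1 - 1 / n) ^ (n - 1) := by
  obtain ⟨N, rfl⟩ : ∃ N, n = N + 2 := ⟨n - 2, by omega⟩
  have h1 : (1 - 1 / ((N + 2 : ℕ) : ℝ)) = (1 + 1 / ((N + 1 : ℕ) : ℝ))⁻¹ := by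
    push_cast
    field_simp
    ring
  rw [h1, inv_pow, one_div, show N + 2 - 1 = N + 1 by omega]
  refine inv_anti₀ (by positivity) ?_
  calc (1 + 1 / ((N + 1 : ℕ) : ℝ)) ^ (N + 1)
      ≤ (Real.exp (1 / ((N + 1 : ℕ) : ℝ))) ^ (N + 1) := by
        gcongr
        rw [add_comm]; exact Real.add_one_le_exp _
    _ = Real.exp 1 := by rw [← Real.exp_nat_mul]; congr 1; field_simp
    _ ≤ 3 := Real.exp_one_lt_three.le

theorem pow_le_one_half (hn : 1 ≤ n) : (1 - 1 / n : ℝ) ^ n ≤ 1 / 2 := by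
  have h := Real.one_sub_div_pow_le_exp_neg (n := n) (t := 1) (by exact_mod_cast hn)
  refine h.trans ?_
  rw [Real.exp_neg, one_div]
  exact inv_anti₀ two_pos (by linarith [Real.add_one_le_exp (1 : ℝ)])

theorem le_totalEffort_open (hBk : 0 ≤ B / k) (hn : 4 ≤ n) {x : ℝ} (hx : x ∈ Icc D.lo D.hi)
    (hx0 : 0 < x) (hxF : D.cdf x = 1 / 2) :
    B / k * (x / 6) ≤ D.totalEffort k n n (winnerTakeAll B) := by
  rw [totalEffort_open_eq _ (by omega)]
  refine mul_le_mul_of_nonneg_left ?_ hBk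
  have h0 := openWeight_nonneg n
  have hc := continuousOn_openWeight n
  obtain ⟨y, hy, hyF⟩ := D.exists_top_quantile (n := n) (by omega)
  have hnR : (4 : ℝ) ≤ n := by exact_mod_cast hn
  have hn4 : (1 : ℝ) / n ≤ 1 / 4 := one_div_le_one_div_of_le (by norm_num) hnR
  have hxy : x ≤ y := D.le_of_cdf_lt (by rw [hxF, hyF]; linarith)
  have h1 := D.le_rankEffort hc h0 (fun u _ => hasDerivAt_openWeight n u) hx.1 hxy hy.2
  simp only [hxF, hyF] at h1
  have hp : ((1 : ℝ) / 2) ^ (n - 1) ≤ 1 / 6 :=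
    (pow_le_pow_of_le_one (by norm_num) (by norm_num) (by omega : 3 ≤ n - 1)).trans (by norm_num)
  have h2 : x / 6 ≤ D.rankEffort (openWeight n) y := by
    have := one_third_le_pow (n := n) (by omega)
    nlinarith
  have hint : Integrable (D.rankEffort (openWeight n)) D.law :=
    Integrable.of_bound (D.rankEffort_mono hc h0).measurable.aestronglyMeasurable
      (D.rankEffort (openWeight n) D.hi) (Eventually.of_forall fun x => by
        rw [Real.norm_of_nonneg (D.rankEffort_nonneg hc h0 x)]
        exact D.rankEffort_le_hi hc x h0)
  have h3 : (1 / n : ℝ) * (x / 6) ≤ ∫ x, D.rankEffort (openWeight n) x ∂D.law := by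
    have : (1 / n : ℝ) = D.law.real (Ici y) := by rw [law_real_Ici, hyF]; ring
    rw [this, ← smul_eq_mul, ← integral_indicator_const _ measurableSet_Ici]
    refine integral_mono ((integrable_const _).indicator measurableSet_Ici) hint fun z => ?_
    exact indicator_le' (fun z hz => h2.trans (D.rankEffort_mono hc h0 hz))
      (fun z _ => D.rankEffort_nonneg hc h0 _) z
  calc x / 6 = n * ((1 / n : ℝ) * (x / 6)) := by field_simp
    _ ≤ _ := by gcongr

theorem totalEffort_pair_le (hBk : 0 ≤ B / k) (hn : 3 ≤ n) :
    D.totalEffort k n 2 (winnerTakeAll B) ≤ B / k * (4 * D.hi * Real.log n) := by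
  rw [totalEffort_pair_eq _ (by omega)]
  refine mul_le_mul_of_nonneg_left ?_ hBk
  have h0 := pairWeight_nonneg (n := n) (by omega)
  have hc := continuousOn_pairWeight (n := n) (by omega)
  have hnR : (3 : ℝ) ≤ n := by exact_mod_cast hn
  refine (D.integral_shortlist_sum_le (D.rankEffort_mono hc h0).measurable
    (D.rankEffort_nonneg hc h0) fun x => D.rankEffort_le_hi hc x h0).trans ?_
  have h1 := D.rankEffort_le hc h0 (hasDerivAt_pairWeight hn) (right_mem_Icc.2 D.lo_lt_hi.le)
  have h2 : ((n : ℝ) - 1) / (n - 2) ≤ 2 := by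
    rw [div_le_iff₀ (by linarith)]; linarith
  have h3 : Real.log ((n : ℝ) - 1) ≤ Real.log n :=
    Real.log_le_log (by linarith) (by linarith)
  have h4 : 0 ≤ Real.log ((n : ℝ) - 1) := Real.log_nonneg (by linarith)
  rw [cdf_hi, show (n : ℝ) - 1 - (n - 2) * 1 = 1 by ring, mul_zero, sub_zero, Real.log_one] at h1
  have h5 : ((n : ℝ) - 1) / (n - 2) * Real.log ((n : ℝ) - 1) ≤ 2 * Real.log n :=
    mul_le_mul h2 h3 h4 two_pos.le
  have h6 := mul_le_mul_of_nonneg_left h5 (D.lo_nonneg.trans D.lo_lt_hi.le)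
  push_cast
  linarith

theorem le_totalEffort_pair (hBk : 0 ≤ B / k) (hn : 16 ≤ n) {x : ℝ} (hx : x ∈ Icc D.lo D.hi)
    (hx0 : 0 < x) (hxF : D.cdf x = 1 / 2) :
    B / k * (x / 4 * Real.log n) ≤ D.totalEffort k n 2 (winnerTakeAll B) := by
  rw [totalEffort_pair_eq _ (by omega)]
  refine mul_le_mul_of_nonneg_left ?_ hBk
  have h0 := pairWeight_nonneg (n := n) (by omega)
  have hc := continuousOn_pairWeight (n := n) (by omega)
  obtain ⟨y, hy, hyF⟩ := D.exists_top_quantile (n := n) (by omega)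
  have hnR : (16 : ℝ) ≤ n := by exact_mod_cast hn
  have hn4 : (1 : ℝ) / n ≤ 1 / 16 := one_div_le_one_div_of_le (by norm_num) hnR
  have hxy : x ≤ y := D.le_of_cdf_lt (by rw [hxF, hyF]; linarith)
  refine le_trans ?_ (D.le_integral_shortlist_sum two_pos (D.rankEffort_mono hc h0)
    (D.rankEffort_nonneg hc h0) (fun x => D.rankEffort_le_hi hc x h0) y)
  have h1 := D.le_rankEffort hc h0 (hasDerivAt_pairWeight (by omega)) hx.1 hxy hy.2
  have hden : (n : ℝ) - 1 - (n - 2) * (1 - 1 / n) = 2 - 2 / n := by field_simp; ring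
  rw [hxF, hyF, hden, show (n : ℝ) - 1 - (n - 2) * (1 / 2) = n / 2 by ring] at h1
  have hlow : Real.log (2 - 2 / n) ≤ Real.log 2 :=
    Real.log_le_log (by rw [show (2 : ℝ) / n = 2 * (1 / n) by ring]; linarith)
      (sub_le_self _ (by positivity))
  have hlogn : 4 * Real.log 2 ≤ Real.log n := by
    rw [show 4 * Real.log 2 = Real.log 16 by
      rw [show (16 : ℝ) = 2 ^ 4 by norm_num, Real.log_pow]; norm_num]
    exact Real.log_le_log (by norm_num) hnR
  have hsplit : Real.log (n / 2) = Real.log n - Real.log 2 :=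
    Real.log_div (by linarith) two_ne_zero
  have hl2 := Real.log_pos one_lt_two
  have hc1 : 1 ≤ ((n : ℝ) - 1) / (n - 2) := by
    rw [le_div_iff₀ (by linarith)]; linarith
  have h3 : Real.log n / 2 ≤ Real.log (n / 2) - Real.log (2 - 2 / n) := by linarith
  have h4 : Real.log n / 2 ≤
      ((n : ℝ) - 1) / (n - 2) * (Real.log (n / 2) - Real.log (2 - 2 / n)) :=
    h3.trans (le_mul_of_one_le_left (by linarith) hc1)
  have h5 : x * (Real.log n / 2) ≤ D.rankEffort (pairWeight n) y := by
    refine (mul_le_mul_of_nonneg_left h4 hx0.le).trans (le_trans (le_of_eq ?_) h1)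
    ring
  have h6 : 1 / 2 ≤ 1 - D.cdf y ^ n := by
    rw [hyF]; linarith [pow_le_one_half (n := n) (by omega)]
  calc x / 4 * Real.log n = x * (Real.log n / 2) * (1 / 2) := by ring
    _ ≤ _ := mul_le_mul h5 h6 (by norm_num) (D.rankEffort_nonneg hc h0 y)

end totals

end AbilityDistribution

end

theorem mainTheorem10 (D : AbilityDistribution) (B k : ℝ) (hB : 0 < B) (hk : 0 < k) :
    (fun n : ℕ => D.totalEffort k n 2 (winnerTakeAll B) / D.totalEffort k n n (winnerTakeAll B))
      =Θ[atTop] (fun n : ℕ => Real.log n) := by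
  have hc : 0 < B / k := div_pos hB hk
  have hhi : 0 < D.hi := D.lo_nonneg.trans_lt D.lo_lt_hi
  obtain ⟨x, hx, hx0, hxF⟩ := D.exists_median
  constructor
  · refine IsBigO.of_bound (4 * D.hi / (x / 6)) ?_
    filter_upwards [eventually_ge_atTop 16] with n hn
    have hlog : 0 ≤ Real.log n := Real.log_natCast_nonneg n
    have h1 := D.totalEffort_pair_le hc.le (by omega : 3 ≤ n)
    have h2 := D.le_totalEffort_open hc.le (by omega : 4 ≤ n) hx hx0 hxF
    have h3 := (by positivity : 0 ≤ B / k * (x / 4 * Real.log n)).trans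
      (D.le_totalEffort_pair hc.le hn hx hx0 hxF)
    have h4 : 0 < B / k * (x / 6) := by positivity
    rw [Real.norm_of_nonneg (div_nonneg h3 (h4.le.trans h2)), Real.norm_of_nonneg hlog]
    refine (div_le_div₀ (by positivity) h1 h4 h2).trans (le_of_eq ?_)
    field_simp
  · refine IsBigO.of_bound (D.hi / (x / 4)) ?_
    filter_upwards [eventually_ge_atTop 16] with n hn
    have hlog : 0 ≤ Real.log n := Real.log_natCast_nonneg n
    have h1 := D.le_totalEffort_pair hc.le hn hx hx0 hxF
    have h2 := D.totalEffort_open_le hc.le (by omega : 2 ≤ n)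
    have h3 := (by positivity : 0 < B / k * (x / 6)).trans_le
      (D.le_totalEffort_open hc.le (by omega : 4 ≤ n) hx hx0 hxF)
    have h4 : 0 ≤ B / k * (x / 4 * Real.log n) := by positivity
    rw [Real.norm_of_nonneg (div_nonneg (h4.trans h1) h3.le), Real.norm_of_nonneg hlog]
    have h5 := div_le_div₀ (h4.trans h1) h1 h3 h2
    refine le_trans (le_of_eq ?_) (mul_le_mul_of_nonneg_left h5 (by positivity))
    field_simp
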